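/- **Setting.** Let $B\subset\mathbb R^3$ be a bounded open set with sufficiently regular boundary: $\partial B$ has finite area (surface measure $dS$ = two-dimensional Hausdorff measure) and there is an outward unit normal field $N$, i.e. a measurable field with $|N|=1$ a.e. on $\partial B$ such that the distributional gradient of $1_B$ is $-N\,dS$ on $\partial B$ (for instance any bounded Lipschitz domain). Let $S_x\subset\partial B$ be measurable, $S_t=\partial B\setminus S_x$, and let $t:S_t\to\mathbb R^3$ be a surface traction. Boundary values of $W^{1,1}(B)$ functions are traces: $g\in L^1(\partial B)$ is the trace of $u$ if some $C^1$ functions on $\mathbb R^3$ converge to $u$ in $W^{1,1}(B)$ and to $g$ in $L^1(\partial B)$. Write $\nabla\chi=(\partial\chi_i/\partial x_j)_{ij}$ (weak derivatives) and $\Lambda(F)=\operatorname{tr}(F^{T}F)$. Let $V$ be a real function that is $C^2$ on $(0,\infty)$ with $V'$ one-to-one there (a canonical function), and let $p\in[1,\infty]$. * $\mathcal X_a$ is the set of $\chi\in W^{1,1}(B;\mathbb R^3)$ that have a trace on $\partial B$ with $\chi=0$ a.e. on $S_x$. $\mathcal X_c$ is the set of $\chi\in\mathcal X_a$ such that $\Lambda(\nabla\chi)>0$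 a.e. in $B$, $\Lambda(\nabla\chi)\in L^p(B)$, $V(\Lambda(\nabla\chi))\in L^1(B)$ and $\chi\cdot t\in L^1(S_t)$. * $\mathcal T_a$ is the set of $T\in W^{1,1}(B;\mathbb R^{3\times3})$ that have a trace on $\partial B$ and satisfy $\sum_j\partial T_{ij}/\partial x_j=0$ a.e. in $B$ and $\sum_jT_{ij}N_j=t_i$ a.e. on $S_t$ ($i=1,2,3$). * Problem $(P)$: $\Pi(\chi)=\int_B V(\Lambda(\nabla\chi))\,dx-\int_{S_t}\chi\cdot t\,dS$ on $\mathcal X_c$. * Problem $(P)_T$, for $T\in\mathcal T_a$: $\Pi_T(\nabla\chi)$ on those $\chi\in\mathcal X_c$ with $\|\nabla\chi\|\,\|T\|\in L^1(B)$, where $\Pi_T(F)=\int_B\big[V(\Lambda(F))-\operatorname{tr}(F^{T}T)\big]dx$ (inside the trace, $F^T$ is the transpose of $F$). * A variation is a $C^2$ field $\varphi:\mathbb R^3\to\mathbb R^3$ with $\varphi=0$ a.e. on $S_x$. An admissible $\bar\chi$ is a stationary solution of $(P)$ (resp. $(P)_T$) if for every variation $\varphi$ the field $\bar\chi+s\varphi$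 is admissible for all sufficiently small $|s|$ and the derivative at $s=0$ of the functional at $\bar\chi+s\varphi$ exists and equals $0$. **Theorem.** Let $T\in\mathcal T_a$. 1. Every stationary solution $\bar\chi\in\mathcal X_c$ of $(P)_T$ is a stationary solution of $(P)$. 2. Let $R\in L^1(B;\mathbb R^{3\times3})$ be a rotation field, $R(x)\in SO(3)$ for all $x\in B$, such that $R^{\mathsf T}T\in\mathcal T_a$. Then $\Pi_T(\nabla\chi)=\Pi_T(R\,\nabla\chi)$ for every $\chi\in\mathcal X_c$ with $\|\nabla\chi\|\,\|T\|\in L^1(B)$. 3. Let $R\in SO(3)$ be a constant rotation such that $R^{\mathsf T}T\in\mathcal T_a$. If $\bar\chi$ is a stationary solution of $(P)$, then so is $R\bar\chi$. -/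

import Mathlib

open MeasureTheory Set Filter Topology
open scoped Matrix ContDiff ENNReal

noncomputable section

namespace Elasticity

/-- Reference space: `ℝ³` with its Euclidean metric and Lebesgue measure. -/
abbrev Space : Type := EuclideanSpace ℝ (Fin 3)

/-- Values of vector fields: triples of components. -/
abbrev Vec : Type := Fin 3 → ℝ

/-- Values of (two-point) tensor fields: real `3 × 3` matrices. -/
abbrev Mat : Type := Matrix (Fin 3) (Fin 3) ℝ

/-- Classical partial derivative `∂ψ/∂xⱼ`. -/
def pderiv (j : Fin 3) (ψ : Space → ℝ) (x : Space) : ℝ :=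
  fderiv ℝ ψ x (EuclideanSpace.single j 1)

/-- Surface measure on `∂B`: the two-dimensional Hausdorff measure, normalised so as to agree with
area, restricted to the topological boundary of `B`. -/
def surf (B : Set Space) : Measure Space := μHE[2].restrict (frontier B)

/-- `B` is a bounded open set with sufficiently regular boundary, and `N` is its outward unit
normal (in the sense of De Giorgi): `∂B` has finite area, `N` is a measurable unit field on `∂B`,
and the distributional gradient of the indicator function of `B` is `-N dS`. Every bounded
Lipschitz domain, with its usual outward unit normal, is of this kind, and `N` is determined by
`B` almost everywhere on `∂B`. -/
structure IsRegularBody (B : Set Space) (N : Space → Vec) : Prop where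
  isOpen : IsOpen B
  isBounded : Bornology.IsBounded B
  area_lt_top : surf B univ < ⊤
  normal_measurable : ∀ j, AEStronglyMeasurable (fun x => N x j) (surf B)
  normal_unit : ∀ᵐ x ∂(surf B), N x ⬝ᵥ N x = 1
  grad_indicator : ∀ (j : Fin 3) (ψ : Space → ℝ), ContDiff ℝ 1 ψ → HasCompactSupport ψ →
    ∫ x in B, pderiv j ψ x = ∫ x, ψ x * N x j ∂(surf B)

/-- `D ∈ L¹(B)` is the weak partial derivative `∂u/∂xⱼ` of `u` in `B`. -/
def IsWeakPartial (B : Set Space) (j : Fin 3) (u D : Space → ℝ) : Prop :=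
  IntegrableOn D B ∧
    ∀ ψ : Space → ℝ, ContDiff ℝ ∞ ψ → HasCompactSupport ψ → tsupport ψ ⊆ B →
      ∫ x in B, u x * pderiv j ψ x = -∫ x in B, D x * ψ x

/-- The Sobolev space `W^{1,1}(B)`. -/
def MemW11 (B : Set Space) (u : Space → ℝ) : Prop :=
  IntegrableOn u B ∧ ∀ j, ∃ D, IsWeakPartial B j u D

open Classical in
/-- The weak partial derivative `∂u/∂xⱼ` in `B` (unique almost everywhere in `B`; the value `0` is
used only where there is none). -/
def weakPartial (B : Set Space) (j : Fin 3) (u : Space → ℝ) : Space → ℝ :=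
  if h : ∃ D, IsWeakPartial B j u D then h.choose else 0

/-- `g ∈ L¹(∂B)` is the trace (boundary value) of `u ∈ W^{1,1}(B)`: the restrictions to `B` and to
`∂B` of some sequence of `C¹` functions on `ℝ³` converge to `u` in `W^{1,1}(B)` and to `g` in
`L¹(∂B)`. -/
def IsTrace (B : Set Space) (u g : Space → ℝ) : Prop :=
  Integrable g (surf B) ∧
    ∃ v : ℕ → Space → ℝ, (∀ n, ContDiff ℝ 1 (v n) ∧ HasCompactSupport (v n)) ∧
      Tendsto (fun n => ∫⁻ x in B, ‖v n x - u x‖ₑ) atTop (𝓝 0) ∧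
      (∀ j, Tendsto (fun n => ∫⁻ x in B, ‖pderiv j (v n) x - weakPartial B j u x‖ₑ)
        atTop (𝓝 0)) ∧
      Tendsto (fun n => ∫⁻ x, ‖v n x - g x‖ₑ ∂(surf B)) atTop (𝓝 0)

open Classical in
/-- The trace of `u` on `∂B` (unique almost everywhere on the boundary of a regular body; the value
`0` is used only where there is none). -/
def trace (B : Set Space) (u : Space → ℝ) : Space → ℝ :=
  if h : ∃ g, IsTrace B u g then h.choose else 0

/-- Trace of a vector field, componentwise. -/
def traceVec (B : Set Space) (χ : Space → Vec) (x : Space) : Vec :=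
  fun i => trace B (fun y => χ y i) x

/-- The deformation gradient `F = ∇χ`, `F i j = ∂χᵢ/∂xⱼ` (weak derivatives). -/
def grad (B : Set Space) (χ : Space → Vec) (x : Space) : Mat :=
  Matrix.of fun i j => weakPartial B j (fun y => χ y i) x

/-- The traction boundary `S_t = ∂B \ S_x`. -/
def tractionBoundary (B Sx : Set Space) : Set Space := frontier B \ Sx

/-- The geometrically admissible space `𝒳ₐ`: `χ ∈ W^{1,1}(B; ℝ³)` with `χ = 0` on `S_x` in the
sense of traces. -/
def GeomAdmissible (B Sx : Set Space) (χ : Space → Vec) : Prop :=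
  ∀ i, MemW11 B (fun x => χ x i) ∧ (∃ g, IsTrace B (fun x => χ x i) g) ∧
    ∀ᵐ x ∂((surf B).restrict Sx), trace B (fun y => χ y i) x = 0

/-- The objective measure `Λ(F) = tr(Fᵀ F)`. -/
def strain (F : Mat) : ℝ := (Fᵀ * F).trace

/-- `V` is a `C²` canonical function on the positive half-line: the duality relation
`ξ ↦ ζ = V'(ξ)` is one-to-one on `ξ > 0` (hence a bijection onto its range). -/
def IsCanonical (V : ℝ → ℝ) : Prop :=
  ContDiffOn ℝ 2 V (Ioi 0) ∧ InjOn (deriv V) (Ioi 0)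

/-- The kinetically admissible space `𝒳_c`: `χ ∈ 𝒳ₐ` with `Λ(∇χ) ∈ ℰₐ`, i.e. `Λ(∇χ) > 0` almost
everywhere in `B` and `Λ(∇χ) ∈ Lᵖ(B)`, for which the total potential is well defined, i.e. the
stored energy and the work of the surface traction `t` are finite. -/
def KinAdmissible (B Sx : Set Space) (t : Space → Vec) (V : ℝ → ℝ) (p : ℝ≥0∞)
    (χ : Space → Vec) : Prop :=
  GeomAdmissible B Sx χ ∧
  (∀ᵐ x ∂(volume.restrict B), 0 < strain (grad B χ x)) ∧
  MemLp (fun x => strain (grad B χ x)) p (volume.restrict B) ∧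
  IntegrableOn (fun x => V (strain (grad B χ x))) B ∧
  Integrable (fun x => traceVec B χ x ⬝ᵥ t x) ((surf B).restrict (tractionBoundary B Sx))

/-- The statically admissible space `𝒯ₐ`: `T ∈ W^{1,1}(B; ℝ^{3×3})` with `∑ⱼ ∂Tᵢⱼ/∂xⱼ = 0` almost
everywhere in `B` and `∑ⱼ Tᵢⱼ Nⱼ = tᵢ` almost everywhere on `S_t`, in the sense of traces. -/
def StatAdmissible (B : Set Space) (N : Space → Vec) (Sx : Set Space) (t : Space → Vec)
    (T : Space → Mat) : Prop :=
  (∀ i j, MemW11 B (fun x => T x i j) ∧ ∃ g, IsTrace B (fun x => T x i j) g) ∧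
  (∀ i, ∀ᵐ x ∂(volume.restrict B), ∑ j, weakPartial B j (fun y => T y i j) x = 0) ∧
  (∀ i, ∀ᵐ x ∂((surf B).restrict (tractionBoundary B Sx)),
    ∑ j, trace B (fun y => T y i j) x * N x j = t x i)

/-- The products of the entries of `F` and `T` are integrable over `B` (equivalently `‖F‖ ‖T‖` is),
so that the stress work `∫ tr(Fᵀ T)` converges absolutely. -/
def FiniteStressWork (B : Set Space) (T F : Space → Mat) : Prop :=
  ∀ i j k l, IntegrableOn (fun x => F x i j * T x k l) B

/-- The total potential `Π(χ) = ∫_B V(Λ(∇χ)) dB - ∫_{S_t} χ · t dS`. -/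
def totalPotential (B Sx : Set Space) (t : Space → Vec) (V : ℝ → ℝ) (χ : Space → Vec) : ℝ :=
  (∫ x in B, V (strain (grad B χ x))) -
    ∫ x, traceVec B χ x ⬝ᵥ t x ∂((surf B).restrict (tractionBoundary B Sx))

/-- The integrand `G(F) = V(Λ(F)) - tr(Fᵀ T)`. -/
def G (V : ℝ → ℝ) (T F : Mat) : ℝ := V (strain F) - (Fᵀ * T).trace

/-- The canonical functional `Π_T(F) = ∫_B G(F) dB`. -/
def canonicalPotential (B : Set Space) (V : ℝ → ℝ) (T F : Space → Mat) : ℝ :=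
  ∫ x in B, G V (T x) (F x)

/-- Variations `δχ`: `C²` fields up to the boundary that vanish on `S_x`. -/
def IsVariation (B Sx : Set Space) (φ : Space → Vec) : Prop :=
  ContDiff ℝ 2 φ ∧ ∀ᵐ x ∂((surf B).restrict Sx), φ x = 0

/-- `χ` is a stationary point of `J` on the admissible class `Adm`: in the direction of every
variation `φ`, `χ + s φ` is admissible for all small `s` and the first variation
`δJ(χ; φ) = d/ds J(χ + s φ)` at `s = 0` exists and vanishes. -/
def IsStationary (B Sx : Set Space) (Adm : (Space → Vec) → Prop) (J : (Space → Vec) → ℝ)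
    (χ : Space → Vec) : Prop :=
  Adm χ ∧ ∀ φ, IsVariation B Sx φ →
    (∀ᶠ s : ℝ in 𝓝 0, Adm (χ + s • φ)) ∧ HasDerivAt (fun s : ℝ => J (χ + s • φ)) 0 0

/-- Stationary solutions of the original problem `(P)`. -/
def IsStationaryP (B Sx : Set Space) (t : Space → Vec) (V : ℝ → ℝ) (p : ℝ≥0∞)
    (χ : Space → Vec) : Prop :=
  IsStationary B Sx (KinAdmissible B Sx t V p) (totalPotential B Sx t V) χ

/-- Stationary solutions of the canonical problem `(P)_T`: the functional `χ ↦ Π_T(∇χ)` on those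
`χ ∈ 𝒳_c` for which `Π_T(∇χ)` is well defined. -/
def IsStationaryPT (B Sx : Set Space) (t : Space → Vec) (V : ℝ → ℝ) (p : ℝ≥0∞)
    (T : Space → Mat) (χ : Space → Vec) : Prop :=
  IsStationary B Sx
    (fun ψ => KinAdmissible B Sx t V p ψ ∧ FiniteStressWork B T (grad B ψ))
    (fun ψ => canonicalPotential B V T (grad B ψ)) χ

/-- The rotation fields `R ∈ L¹(B; ℝ^{3×3})` with `R(x) ∈ SO(3)` for all `x ∈ B`. -/
def IsRotationField (B : Set Space) (R : Space → Mat) : Prop :=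
  (∀ i j, IntegrableOn (fun x => R x i j) B) ∧
    ∀ x ∈ B, R x ∈ Matrix.specialOrthogonalGroup (Fin 3) ℝ

end Elasticity

end

/-!
The first two claims rest on the principle of virtual work for a divergence-free `S ∈ W^{1,1}`,
`∫_B ∇u · S dx = ∫_{∂B} u S·N dS` (`HasGradTrace.integral_grad_mul`), where `u` is a component of a
deformation or of a variation and vanishes on `S_x`; the third rests on invariance under rotations.

* A stationary point of `Π_T` is one of `Π`: along `χ + s φ` the two functionals differ by the
  stress work minus the work of the traction, which is affine in `s`, and its slope
  `∫_B tr(∇φᵀ T) - ∫_{S_t} φ · t` vanishes by virtual work.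
* `Λ(R F) = Λ(F)`, and `tr((R∇χ)ᵀ T) = tr(∇χᵀ (Rᵀ T))`. The stress `T - Rᵀ T` is divergence-free
  with zero traction on `S_t`, so `T` and `Rᵀ T` do the same work on `∇χ`.
* For a constant `R`, the stresses `T` and `Rᵀ T` having the same traction `t` gives `Rᵀ t = t` on
  `S_t`. Hence `Π(R χ) = Π(χ)`, and the variation `φ` at `R χ` corresponds to `Rᵀ φ` at `χ`.

In the second claim `u` and `S` are only in `W^{1,1}`, and neither factor need be bounded: all that
is known is that the products `∂u/∂xⱼ Sⱼ` are integrable. The formula therefore holds first for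
bounded `C¹` truncations `τ(u)` and `σ(Sⱼ)`, by approximation with `C¹` functions and the
divergence theorem (`trunc_mul_trunc`, `integral_grad`). The truncation of `S` is released first, by
dominated convergence with `u` still truncated (`integral_trunc_mul`). It is applied to each entry separately
and so destroys `div S = 0`, but since every entry of `S` is in `W^{1,1}` the divergence of the
truncated field tends to `div S = 0` in `L¹`. The truncation of `u` is released afterwards.

Weak derivatives and traces are chosen representatives; `weakPartial_ae_eq` and `trace_ae_eq` show
that they agree almost everywhere with any gradient and boundary values obtained by approximation,
which makes them linear.
-/

namespace Elasticity

/-! ### Convergence in `L¹` -/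

section Convergence

variable {α : Type*} [MeasurableSpace α] {μ : Measure α}

lemma tendsto_L1_comp_add {a b : ℕ → α → ℝ} {f g : α → ℝ}
    (hma : ∀ n, AEStronglyMeasurable (a n) μ) (hmf : AEStronglyMeasurable f μ)
    (ha : Tendsto (fun n => ∫⁻ x, ‖a n x - f x‖ₑ ∂μ) atTop (𝓝 0))
    (hb : Tendsto (fun n => ∫⁻ x, ‖b n x - g x‖ₑ ∂μ) atTop (𝓝 0)) :
    Tendsto (fun n => ∫⁻ x, ‖(a n x + b n x) - (f x + g x)‖ₑ ∂μ) atTop (𝓝 0) := by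
  have h := ha.add hb
  rw [add_zero] at h
  refine tendsto_of_tendsto_of_tendsto_of_le_of_le tendsto_const_nhds h (fun _ => zero_le) fun n => ?_
  have hm : AEMeasurable (fun x => ‖a n x - f x‖ₑ) μ := ((hma n).sub hmf).enorm
  rw [← lintegral_add_left' hm]
  refine lintegral_mono fun x => ?_
  rw [add_sub_add_comm]
  exact enorm_add_le _ _

lemma tendsto_L1_const_mul {a : ℕ → α → ℝ} {f : α → ℝ} (c : ℝ)
    (ha : Tendsto (fun n => ∫⁻ x, ‖a n x - f x‖ₑ ∂μ) atTop (𝓝 0)) :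
    Tendsto (fun n => ∫⁻ x, ‖c * a n x - c * f x‖ₑ ∂μ) atTop (𝓝 0) := by
  have h := ENNReal.Tendsto.const_mul (a := ‖c‖ₑ) ha (Or.inr enorm_ne_top)
  rw [mul_zero] at h
  refine h.congr fun n => ?_
  rw [← lintegral_const_mul' _ _ enorm_ne_top]
  simp_rw [← mul_sub, enorm_mul]

/-- The product of a sequence converging in `L¹` and a uniformly bounded sequence converging almost
everywhere converges in `L¹` to the product of the limits. -/
lemma tendsto_L1_mul_bdd {a b : ℕ → α → ℝ} {f g : α → ℝ} {C : ℝ}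
    (hma : ∀ n, AEStronglyMeasurable (a n) μ) (hf : Integrable f μ)
    (ha : Tendsto (fun n => ∫⁻ x, ‖a n x - f x‖ₑ ∂μ) atTop (𝓝 0))
    (hmb : ∀ n, AEStronglyMeasurable (b n) μ) (hmg : AEStronglyMeasurable g μ)
    (hC : ∀ n, ∀ᵐ x ∂μ, |b n x| ≤ C)
    (hb : ∀ᵐ x ∂μ, Tendsto (fun n => b n x) atTop (𝓝 (g x))) :
    Tendsto (fun n => ∫⁻ x, ‖a n x * b n x - f x * g x‖ₑ ∂μ) atTop (𝓝 0) := by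
  have h1 : Tendsto (fun n => ENNReal.ofReal C * ∫⁻ x, ‖a n x - f x‖ₑ ∂μ) atTop (𝓝 0) := by
    simpa using ENNReal.Tendsto.const_mul (a := ENNReal.ofReal C) ha (Or.inr ENNReal.ofReal_ne_top)
  have hg : ∀ᵐ x ∂μ, |g x| ≤ C := by
    filter_upwards [hb, ae_all_iff.2 hC] with x hx hx'
    exact le_of_tendsto hx.abs (Eventually.of_forall hx')
  have h2 : Tendsto (fun n => ∫⁻ x, ‖f x * (b n x - g x)‖ₑ ∂μ) atTop (𝓝 (∫⁻ _, 0 ∂μ)) := by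
    refine tendsto_lintegral_of_dominated_convergence'
      (fun x => ENNReal.ofReal (2 * C) * ‖f x‖ₑ) (fun n => ?_) (fun n => ?_) ?_ ?_
    · exact (hf.1.mul ((hmb n).sub hmg)).enorm
    · filter_upwards [hC n, hg] with x hx hx'
      rw [enorm_mul, mul_comm]
      gcongr
      rw [Real.enorm_eq_ofReal_abs]
      refine ENNReal.ofReal_le_ofReal ((abs_sub _ _).trans ?_)
      linarith
    · rw [lintegral_const_mul' _ _ ENNReal.ofReal_ne_top]
      exact ENNReal.mul_ne_top ENNReal.ofReal_ne_top hf.2.ne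
    · filter_upwards [hb] with x hx
      have : Tendsto (fun n => f x * (b n x - g x)) atTop (𝓝 (f x * (g x - g x))) :=
        (hx.sub_const _).const_mul _
      simpa using this.enorm
  have h := h1.add h2
  rw [lintegral_zero, add_zero] at h
  refine tendsto_of_tendsto_of_tendsto_of_le_of_le tendsto_const_nhds h (fun _ => zero_le) fun n => ?_
  simp only
  have hm : AEMeasurable (fun x => ‖a n x - f x‖ₑ) μ := ((hma n).sub hf.1).enorm
  rw [← lintegral_const_mul' _ _ ENNReal.ofReal_ne_top,
    ← lintegral_add_left' (hm.const_mul _)]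
  refine lintegral_mono_ae ?_
  filter_upwards [hC n] with x hx
  have : a n x * b n x - f x * g x = b n x * (a n x - f x) + f x * (b n x - g x) := by ring
  rw [this]
  refine (enorm_add_le _ _).trans ?_
  rw [enorm_mul (b n x)]
  gcongr
  rw [Real.enorm_eq_ofReal_abs]
  exact ENNReal.ofReal_le_ofReal hx

lemma exists_subseq_ae_tendsto_of_L1 {a : ℕ → α → ℝ} {f : α → ℝ}
    (hma : ∀ n, AEStronglyMeasurable (a n) μ) (hmf : AEStronglyMeasurable f μ)
    (ha : Tendsto (fun n => ∫⁻ x, ‖a n x - f x‖ₑ ∂μ) atTop (𝓝 0)) :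
    ∃ ns : ℕ → ℕ, StrictMono ns ∧ ∀ᵐ x ∂μ, Tendsto (fun n => a (ns n) x) atTop (𝓝 (f x)) := by
  refine (tendstoInMeasure_of_tendsto_eLpNorm (p := 1) one_ne_zero hma hmf ?_).exists_seq_tendsto_ae
  simpa only [eLpNorm_one_eq_lintegral_enorm, Pi.sub_apply] using ha

end Convergence

/-! ### Sobolev functions with prescribed gradient and trace -/

lemma continuous_pderiv {ψ : Space → ℝ} (hψ : ContDiff ℝ 1 ψ) (j : Fin 3) :
    Continuous (pderiv j ψ) :=
  (hψ.continuous_fderiv one_ne_zero).clm_apply continuous_const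

lemma pderiv_mul {ψ η : Space → ℝ} (hψ : ContDiff ℝ 1 ψ) (hη : ContDiff ℝ 1 η) (j : Fin 3)
    (x : Space) :
    pderiv j (fun y => ψ y * η y) x = pderiv j ψ x * η x + pderiv j η x * ψ x := by
  have h1 := (hψ.differentiable one_ne_zero x)
  have h2 := (hη.differentiable one_ne_zero x)
  unfold pderiv
  rw [fderiv_fun_mul h1 h2]
  simp
  ring

lemma pderiv_comp {τ : ℝ → ℝ} (hτ : ContDiff ℝ 1 τ) {ψ : Space → ℝ} (hψ : ContDiff ℝ 1 ψ)
    (j : Fin 3) (x : Space) :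
    pderiv j (fun y => τ (ψ y)) x = pderiv j ψ x * deriv τ (ψ x) := by
  have h1 := (hψ.differentiable one_ne_zero x)
  have h2 := (hτ.differentiable one_ne_zero (ψ x))
  unfold pderiv
  rw [show (fun y => τ (ψ y)) = τ ∘ ψ from rfl, fderiv_comp x h2 h1]
  simp [mul_comm]

lemma pderiv_add {ψ η : Space → ℝ} (hψ : ContDiff ℝ 1 ψ) (hη : ContDiff ℝ 1 η) (j : Fin 3)
    (x : Space) : pderiv j (fun y => ψ y + η y) x = pderiv j ψ x + pderiv j η x := by
  unfold pderiv
  rw [fderiv_fun_add (hψ.differentiable one_ne_zero x) (hη.differentiable one_ne_zero x)]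
  rfl

lemma pderiv_const_mul {ψ : Space → ℝ} (hψ : ContDiff ℝ 1 ψ) (c : ℝ) (j : Fin 3)
    (x : Space) : pderiv j (fun y => c * ψ y) x = c * pderiv j ψ x := by
  unfold pderiv
  rw [fderiv_const_mul (hψ.differentiable one_ne_zero x)]
  rfl

/-- `u ∈ L¹(B)` has the integrable gradient `D` in `B` and the integrable boundary values `g` on
`∂B`, in the strong sense: some `C¹` functions of compact support approximate `u`, `D` and `g`
simultaneously in `L¹`. Unlike `weakPartial` and `trace`, the gradient and the boundary values are
data here, so that this relation is visibly linear and stable under products and compositions. -/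
structure HasGradTrace (B : Set Space) (u : Space → ℝ) (D : Fin 3 → Space → ℝ)
    (g : Space → ℝ) : Prop where
  integrable : IntegrableOn u B
  integrable_grad : ∀ j, IntegrableOn (D j) B
  integrable_trace : Integrable g (surf B)
  approx : ∃ v : ℕ → Space → ℝ, (∀ n, ContDiff ℝ 1 (v n) ∧ HasCompactSupport (v n)) ∧
      Tendsto (fun n => ∫⁻ x in B, ‖v n x - u x‖ₑ) atTop (𝓝 0) ∧
      (∀ j, Tendsto (fun n => ∫⁻ x in B, ‖pderiv j (v n) x - D j x‖ₑ) atTop (𝓝 0)) ∧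
      Tendsto (fun n => ∫⁻ x, ‖v n x - g x‖ₑ ∂(surf B)) atTop (𝓝 0)

namespace HasGradTrace

variable {B : Set Space} {u w : Space → ℝ} {D E : Fin 3 → Space → ℝ} {g h : Space → ℝ}

/-- The approximating functions may be taken to converge almost everywhere as well. -/
lemma approx_ae (hu : HasGradTrace B u D g) :
    ∃ v : ℕ → Space → ℝ, (∀ n, ContDiff ℝ 1 (v n) ∧ HasCompactSupport (v n)) ∧
      Tendsto (fun n => ∫⁻ x in B, ‖v n x - u x‖ₑ) atTop (𝓝 0) ∧
      (∀ j, Tendsto (fun n => ∫⁻ x in B, ‖pderiv j (v n) x - D j x‖ₑ) atTop (𝓝 0)) ∧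
      Tendsto (fun n => ∫⁻ x, ‖v n x - g x‖ₑ ∂(surf B)) atTop (𝓝 0) ∧
      (∀ᵐ x ∂(volume.restrict B), Tendsto (fun n => v n x) atTop (𝓝 (u x))) ∧
      ∀ᵐ x ∂(surf B), Tendsto (fun n => v n x) atTop (𝓝 (g x)) := by
  obtain ⟨v, hv, h1, h2, h3⟩ := hu.approx
  obtain ⟨ns, hns, h4⟩ := exists_subseq_ae_tendsto_of_L1
    (fun n => (hv n).1.continuous.aestronglyMeasurable) hu.integrable.1 h1
  obtain ⟨ms, hms, h5⟩ := exists_subseq_ae_tendsto_of_L1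
    (fun n => (hv (ns n)).1.continuous.aestronglyMeasurable) hu.integrable_trace.1
    (h3.comp hns.tendsto_atTop)
  have hnm := (hns.comp hms).tendsto_atTop
  refine ⟨fun n => v (ns (ms n)), fun n => hv _, h1.comp hnm, fun j => (h2 j).comp hnm,
    h3.comp hnm, ?_, h5⟩
  filter_upwards [h4] with x hx
  exact hx.comp hms.tendsto_atTop

lemma add (hu : HasGradTrace B u D g) (hw : HasGradTrace B w E h) :
    HasGradTrace B (fun x => u x + w x) (fun j x => D j x + E j x) (fun x => g x + h x) := by
  obtain ⟨v, hv, h1, h2, h3⟩ := hu.approx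
  obtain ⟨v', hv', h1', h2', h3'⟩ := hw.approx
  refine ⟨hu.integrable.add hw.integrable,
    fun j => (hu.integrable_grad j).add (hw.integrable_grad j),
    hu.integrable_trace.add hw.integrable_trace, fun n x => v n x + v' n x,
    fun n => ⟨(hv n).1.add (hv' n).1, (hv n).2.add (hv' n).2⟩, ?_, fun j => ?_, ?_⟩
  · exact tendsto_L1_comp_add (fun n => (hv n).1.continuous.aestronglyMeasurable) hu.integrable.1
      h1 h1'
  · simp_rw [fun n => pderiv_add (hv n).1 (hv' n).1 j]
    exact tendsto_L1_comp_add (fun n => (continuous_pderiv (hv n).1 j).aestronglyMeasurable)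
      (hu.integrable_grad j).1 (h2 j) (h2' j)
  · exact tendsto_L1_comp_add (fun n => (hv n).1.continuous.aestronglyMeasurable)
      hu.integrable_trace.1 h3 h3'

lemma const_mul (c : ℝ) (hu : HasGradTrace B u D g) :
    HasGradTrace B (fun x => c * u x) (fun j x => c * D j x) (fun x => c * g x) := by
  obtain ⟨v, hv, h1, h2, h3⟩ := hu.approx
  refine ⟨hu.integrable.const_mul c, fun j => (hu.integrable_grad j).const_mul c,
    hu.integrable_trace.const_mul c, fun n x => c * v n x,
    fun n => ⟨contDiff_const.mul (hv n).1, (hv n).2.mul_left⟩, tendsto_L1_const_mul c h1,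
    fun j => ?_, tendsto_L1_const_mul c h3⟩
  simp_rw [fun n => pderiv_const_mul (hv n).1 c j]
  exact tendsto_L1_const_mul c (h2 j)

lemma zero : HasGradTrace B (fun _ => 0) (fun _ _ => 0) (fun _ => 0) := by
  refine ⟨integrable_zero _ _ _, fun _ => integrable_zero _ _ _, integrable_zero _ _ _,
    fun _ _ => 0, fun _ => ⟨contDiff_const, HasCompactSupport.zero⟩, ?_, ?_, ?_⟩ <;>
  simp [pderiv]

lemma sum {ι : Type*} (s : Finset ι) {u : ι → Space → ℝ} {D : ι → Fin 3 → Space → ℝ}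
    {g : ι → Space → ℝ} (hu : ∀ i, HasGradTrace B (u i) (D i) (g i)) :
    HasGradTrace B (fun x => ∑ i ∈ s, u i x) (fun j x => ∑ i ∈ s, D i j x)
      (fun x => ∑ i ∈ s, g i x) := by
  classical
  induction s using Finset.induction_on with
  | empty => simpa using zero
  | insert a s ha ih => simpa only [Finset.sum_insert ha] using (hu a).add ih

end HasGradTrace

lemma IsRegularBody.isFiniteMeasure_surf {B : Set Space} {N : Space → Vec}
    (hB : IsRegularBody B N) : IsFiniteMeasure (surf B) := ⟨hB.area_lt_top⟩

lemma IsRegularBody.isFiniteMeasure_restrict {B : Set Space} {N : Space → Vec}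
    (hB : IsRegularBody B N) : IsFiniteMeasure (volume.restrict B) :=
  ⟨by simpa using hB.isBounded.measure_lt_top⟩

lemma IsRegularBody.abs_normal_le {B : Set Space} {N : Space → Vec} (hB : IsRegularBody B N)
    (j : Fin 3) : ∀ᵐ x ∂(surf B), |N x j| ≤ 1 := by
  filter_upwards [hB.normal_unit] with x hx
  rw [abs_le_one_iff_mul_self_le_one, ← hx]
  exact Finset.single_le_sum (f := fun i => N x i * N x i) (fun i _ => mul_self_nonneg _)
    (Finset.mem_univ j)

namespace HasGradTrace

variable {B : Set Space} {N : Space → Vec} {u w : Space → ℝ} {D E : Fin 3 → Space → ℝ}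
  {g h : Space → ℝ}

/-- The divergence theorem, by passage to the limit from `C¹` functions. -/
lemma integral_grad (hB : IsRegularBody B N) (hu : HasGradTrace B u D g) (j : Fin 3) :
    ∫ x in B, D j x = ∫ x, g x * N x j ∂(surf B) := by
  have := hB.isFiniteMeasure_surf
  obtain ⟨v, hv, h1, h2, h3⟩ := hu.approx
  have hint (n : ℕ) : Integrable (v n) (surf B) := (hv n).1.continuous.integrable_of_hasCompactSupport (hv n).2
  have e1 : Tendsto (fun n => ∫ x in B, pderiv j (v n) x) atTop (𝓝 (∫ x in B, D j x)) := by
    refine tendsto_integral_of_L1 _ (hu.integrable_grad j).1 (Eventually.of_forall fun n => ?_) (h2 j)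
    exact ((continuous_pderiv (hv n).1 j).integrable_of_hasCompactSupport
      ((hv n).2.fderiv_apply ℝ _)).integrableOn
  have e2 : Tendsto (fun n => ∫ x, v n x * N x j ∂(surf B)) atTop
      (𝓝 (∫ x, g x * N x j ∂(surf B))) := by
    refine tendsto_integral_of_L1 _ (hu.integrable_trace.1.mul (hB.normal_measurable j))
      (Eventually.of_forall fun n => ?_) ?_
    · exact (hint n).mul_bdd (hB.normal_measurable j) (hB.abs_normal_le j)
    · exact tendsto_L1_mul_bdd (C := 1) (fun n => (hint n).1) hu.integrable_trace h3
        (fun _ => hB.normal_measurable j) (hB.normal_measurable j)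
        (fun _ => hB.abs_normal_le j) (Eventually.of_forall fun x => tendsto_const_nhds)
  refine tendsto_nhds_unique e1 (e2.congr fun n => ?_)
  exact (hB.grad_indicator j (v n) (hv n).1 (hv n).2).symm

lemma mul_smooth (hu : HasGradTrace B u D g) {ψ : Space → ℝ} (hψ : ContDiff ℝ 1 ψ)
    (hψc : HasCompactSupport ψ) :
    HasGradTrace B (fun x => u x * ψ x) (fun j x => D j x * ψ x + u x * pderiv j ψ x)
      (fun x => g x * ψ x) := by
  obtain ⟨v, hv, h1, h2, h3⟩ := hu.approx
  obtain ⟨C, hC⟩ := hψ.continuous.bounded_above_of_compact_support hψc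
  have hdc := fun j => continuous_pderiv hψ j
  have hd : ∀ j, ∃ C, ∀ x, ‖pderiv j ψ x‖ ≤ C := fun j =>
    (hdc j).bounded_above_of_compact_support (hψc.fderiv_apply ℝ _)
  choose C' hC' using hd
  have hm (μ : Measure Space) : AEStronglyMeasurable ψ μ := hψ.continuous.aestronglyMeasurable
  have hvm (n : ℕ) (μ : Measure Space) : AEStronglyMeasurable (v n) μ :=
    (hv n).1.continuous.aestronglyMeasurable
  have hpm (n : ℕ) (j) (μ : Measure Space) : AEStronglyMeasurable (pderiv j (v n)) μ :=
    (continuous_pderiv (hv n).1 j).aestronglyMeasurable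
  have hdm (j) (μ : Measure Space) : AEStronglyMeasurable (pderiv j ψ) μ :=
    (hdc j).aestronglyMeasurable
  refine ⟨hu.integrable.mul_bdd (hm _) (Eventually.of_forall hC), fun j => ?_,
    hu.integrable_trace.mul_bdd (hm _) (Eventually.of_forall hC), fun n x => v n x * ψ x,
    fun n => ⟨(hv n).1.mul hψ, (hv n).2.mul_right⟩, ?_, fun j => ?_, ?_⟩
  · exact ((hu.integrable_grad j).mul_bdd (hm _) (Eventually.of_forall hC)).add
      (hu.integrable.mul_bdd (hdm j _) (Eventually.of_forall (hC' j)))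
  · exact tendsto_L1_mul_bdd (hvm · _) hu.integrable h1 (fun _ => hm _) (hm _)
      (fun _ => Eventually.of_forall hC) (Eventually.of_forall fun x => tendsto_const_nhds)
  · simp_rw [fun n => pderiv_mul (hv n).1 hψ j, mul_comm (pderiv j ψ _)]
    refine tendsto_L1_comp_add (fun n => (hpm n j _).mul (hm _)) ((hu.integrable_grad j).1.mul (hm _)) ?_ ?_
    · exact tendsto_L1_mul_bdd (hpm · j _) (hu.integrable_grad j) (h2 j) (fun _ => hm _) (hm _)
        (fun _ => Eventually.of_forall hC) (Eventually.of_forall fun x => tendsto_const_nhds)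
    · exact tendsto_L1_mul_bdd (hvm · _) hu.integrable h1 (fun _ => hdm j _) (hdm j _)
        (fun _ => Eventually.of_forall (hC' j)) (Eventually.of_forall fun x => tendsto_const_nhds)
  · exact tendsto_L1_mul_bdd (hvm · _) hu.integrable_trace h3 (fun _ => hm _) (hm _)
      (fun _ => Eventually.of_forall hC) (Eventually.of_forall fun x => tendsto_const_nhds)

end HasGradTrace

/-! ### Truncations and the integration by parts formula -/

/-- `τ` is a bounded `C¹` function with `τ 0 = 0` and slope at most one. -/
structure IsTruncation (τ : ℝ → ℝ) : Prop where
  contDiff : ContDiff ℝ 1 τ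
  map_zero : τ 0 = 0
  bounded : ∃ C, ∀ s, |τ s| ≤ C
  abs_deriv_le : ∀ s, |deriv τ s| ≤ 1

lemma IsTruncation.abs_le {τ : ℝ → ℝ} (hτ : IsTruncation τ) (s : ℝ) : |τ s| ≤ |s| := by
  have h := lipschitzWith_of_nnnorm_deriv_le (C := 1) (hτ.contDiff.differentiable one_ne_zero)
    (fun x => by simpa [← NNReal.coe_le_coe] using hτ.abs_deriv_le x)
  simpa [Real.dist_eq, hτ.map_zero] using h.dist_le_mul s 0

lemma IsTruncation.continuous_deriv {τ : ℝ → ℝ} (hτ : IsTruncation τ) : Continuous (deriv τ) :=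
  hτ.contDiff.continuous_deriv_one

/-- The truncations `s ↦ k arctan (s / k)`, `k = n + 1`, which tend to the identity together with
their derivatives as `n → ∞`. -/
noncomputable def arctanTrunc (n : ℕ) (s : ℝ) : ℝ := ((n : ℝ) + 1) * Real.arctan (s / ((n : ℝ) + 1))

lemma hasDerivAt_arctanTrunc (n : ℕ) (s : ℝ) :
    HasDerivAt (arctanTrunc n) (1 / (1 + (s / ((n : ℝ) + 1)) ^ 2)) s := by
  have hn : ((n : ℝ) + 1) ≠ 0 := by positivity
  have h := (((hasDerivAt_id s).div_const ((n : ℝ) + 1)).arctan).const_mul ((n : ℝ) + 1)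
  refine h.congr_deriv ?_
  simp only [id]
  field_simp

lemma isTruncation_arctanTrunc (n : ℕ) : IsTruncation (arctanTrunc n) where
  contDiff := contDiff_const.mul (Real.contDiff_arctan.comp (contDiff_id.div_const _))
  map_zero := by simp [arctanTrunc]
  bounded := by
    refine ⟨((n : ℝ) + 1) * (Real.pi / 2), fun s => ?_⟩
    rw [arctanTrunc, abs_mul, abs_of_pos (by positivity : (0 : ℝ) < (n : ℝ) + 1)]
    gcongr
    exact abs_le.2 ⟨(Real.neg_pi_div_two_lt_arctan _).le, (Real.arctan_lt_pi_div_two _).le⟩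
  abs_deriv_le s := by
    rw [(hasDerivAt_arctanTrunc n s).deriv, abs_of_pos (by positivity), div_le_one (by positivity)]
    nlinarith [sq_nonneg (s / ((n : ℝ) + 1))]

lemma tendsto_div_natCast_succ (s : ℝ) :
    Tendsto (fun n : ℕ => s / ((n : ℝ) + 1)) atTop (𝓝 0) :=
  tendsto_const_nhds.div_atTop (tendsto_natCast_atTop_atTop.atTop_add tendsto_const_nhds)

lemma tendsto_deriv_arctanTrunc (s : ℝ) :
    Tendsto (fun n => deriv (arctanTrunc n) s) atTop (𝓝 1) := by
  simp_rw [fun n => (hasDerivAt_arctanTrunc n s).deriv]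
  have h := ((tendsto_div_natCast_succ s).pow 2).const_add 1
  rw [zero_pow two_ne_zero, add_zero] at h
  simpa using h.inv₀ one_ne_zero

lemma tendsto_arctanTrunc (s : ℝ) : Tendsto (fun n => arctanTrunc n s) atTop (𝓝 s) := by
  rcases eq_or_ne s 0 with rfl | hs
  · simp [arctanTrunc]
  have h : Tendsto (fun y : ℝ => y⁻¹ • (Real.arctan (0 + y) - Real.arctan 0)) (𝓝[≠] 0) (𝓝 1) := by
    simpa using (Real.hasDerivAt_arctan 0).tendsto_slope_zero
  have h' := (h.comp (tendsto_nhdsWithin_iff.2 ⟨tendsto_div_natCast_succ s,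
    Eventually.of_forall fun n => div_ne_zero hs (by positivity)⟩)).const_mul s
  rw [mul_one] at h'
  refine h'.congr fun n => ?_
  simp only [Function.comp, zero_add, Real.arctan_zero, sub_zero, smul_eq_mul, arctanTrunc]
  field_simp

namespace HasGradTrace

variable {B : Set Space} {N : Space → Vec} {u w : Space → ℝ} {D E : Fin 3 → Space → ℝ}
  {g h : Space → ℝ}

/-- Chain and product rules for truncated functions. -/
lemma trunc_mul_trunc (hB : IsRegularBody B N) (hu : HasGradTrace B u D g)
    (hw : HasGradTrace B w E h) {τ σ : ℝ → ℝ} (hτ : IsTruncation τ) (hσ : IsTruncation σ) :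
    HasGradTrace B (fun x => τ (u x) * σ (w x))
      (fun j x => D j x * (deriv τ (u x) * σ (w x)) + E j x * (τ (u x) * deriv σ (w x)))
      (fun x => τ (g x) * σ (h x)) := by
  have := hB.isFiniteMeasure_surf
  have := hB.isFiniteMeasure_restrict
  obtain ⟨v, hv, h1, h2, h3, h4, h5⟩ := hu.approx_ae
  obtain ⟨v', hv', h1', h2', h3', h4', h5'⟩ := hw.approx_ae
  obtain ⟨C, hC⟩ := hτ.bounded
  obtain ⟨C', hC'⟩ := hσ.bounded
  have cτ := hτ.contDiff.continuous
  have cσ := hσ.contDiff.continuous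
  have cτ' := hτ.continuous_deriv
  have cσ' := hσ.continuous_deriv
  have hC0 : 0 ≤ C := (abs_nonneg _).trans (hC 0)
  have b1 (a b : ℝ) : |τ a * σ b| ≤ C * C' := by
    rw [abs_mul]; exact mul_le_mul (hC _) (hC' _) (abs_nonneg _) hC0
  have b2 (a b : ℝ) : |deriv τ a * σ b| ≤ 1 * C' := by
    rw [abs_mul]; exact mul_le_mul (hτ.abs_deriv_le _) (hC' _) (abs_nonneg _) zero_le_one
  have b3 (a b : ℝ) : |τ a * deriv σ b| ≤ C * 1 := by
    rw [abs_mul]; exact mul_le_mul (hC _) (hσ.abs_deriv_le _) (abs_nonneg _) hC0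
  have meas {f k : ℝ → ℝ} (hf : Continuous f) (hk : Continuous k) {a b : Space → ℝ}
      {μ : Measure Space} (ha : AEStronglyMeasurable a μ) (hb : AEStronglyMeasurable b μ) :
      AEStronglyMeasurable (fun x => f (a x) * k (b x)) μ :=
    (hf.comp_aestronglyMeasurable ha).mul (hk.comp_aestronglyMeasurable hb)
  have lim {f k : ℝ → ℝ} (hf : Continuous f) (hk : Continuous k) {a b : ℕ → Space → ℝ}
      {a' b' : Space → ℝ} {μ : Measure Space}
      (ha : ∀ᵐ x ∂μ, Tendsto (fun n => a n x) atTop (𝓝 (a' x)))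
      (hb : ∀ᵐ x ∂μ, Tendsto (fun n => b n x) atTop (𝓝 (b' x))) :
      ∀ᵐ x ∂μ, Tendsto (fun n => f (a n x) * k (b n x)) atTop (𝓝 (f (a' x) * k (b' x))) := by
    filter_upwards [ha, hb] with x hx hx'
    exact ((hf.tendsto _).comp hx).mul ((hk.tendsto _).comp hx')
  have mu := hu.integrable.1
  have mw := hw.integrable.1
  have mg := hu.integrable_trace.1
  have mh := hw.integrable_trace.1
  have mv (n : ℕ) (μ : Measure Space) : AEStronglyMeasurable (v n) μ :=
    (hv n).1.continuous.aestronglyMeasurable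
  have mv' (n : ℕ) (μ : Measure Space) : AEStronglyMeasurable (v' n) μ :=
    (hv' n).1.continuous.aestronglyMeasurable
  have mp (n : ℕ) (j) (μ : Measure Space) : AEStronglyMeasurable (pderiv j (v n)) μ :=
    (continuous_pderiv (hv n).1 j).aestronglyMeasurable
  have mp' (n : ℕ) (j) (μ : Measure Space) : AEStronglyMeasurable (pderiv j (v' n)) μ :=
    (continuous_pderiv (hv' n).1 j).aestronglyMeasurable
  -- On a finite measure space, bounded almost everywhere convergence gives convergence in `L¹`.
  have bdd {μ : Measure Space} [IsFiniteMeasure μ] {b : ℕ → Space → ℝ} {k : Space → ℝ} {K : ℝ}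
      (hmb : ∀ n, AEStronglyMeasurable (b n) μ) (hmk : AEStronglyMeasurable k μ)
      (hK : ∀ n x, |b n x| ≤ K)
      (hb : ∀ᵐ x ∂μ, Tendsto (fun n => b n x) atTop (𝓝 (k x))) :
      Tendsto (fun n => ∫⁻ x, ‖b n x - k x‖ₑ ∂μ) atTop (𝓝 0) := by
    simpa using tendsto_L1_mul_bdd (a := fun _ _ => 1) (f := fun _ => 1)
      (fun _ => aestronglyMeasurable_const) (integrable_const _) (by simp) hmb hmk
      (fun n => Eventually.of_forall (hK n)) hb
  refine ⟨Integrable.of_bound (meas cτ cσ mu mw) (C * C') (Eventually.of_forall fun x => b1 _ _), fun j => ?_,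
    .of_bound (meas cτ cσ mg mh) (C * C') (Eventually.of_forall fun x => b1 _ _),
    fun n x => τ (v n x) * σ (v' n x), fun n => ⟨?_, ?_⟩, ?_, fun j => ?_, ?_⟩
  · exact ((hu.integrable_grad j).mul_bdd (meas cτ' cσ mu mw) (Eventually.of_forall fun x => b2 _ _)).add
      ((hw.integrable_grad j).mul_bdd (meas cτ cσ' mu mw) (Eventually.of_forall fun x => b3 _ _))
  · exact (hτ.contDiff.comp (hv n).1).mul (hσ.contDiff.comp (hv' n).1)
  · exact ((hv n).2.comp_left hτ.map_zero).mul_right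
  · exact bdd (fun n => meas cτ cσ (mv n _) (mv' n _)) (meas cτ cσ mu mw) (fun n x => b1 _ _)
      (lim cτ cσ h4 h4')
  · have e (n : ℕ) (x : Space) : pderiv j (fun y => τ (v n y) * σ (v' n y)) x =
        pderiv j (v n) x * (deriv τ (v n x) * σ (v' n x)) +
          pderiv j (v' n) x * (τ (v n x) * deriv σ (v' n x)) := by
      rw [pderiv_mul (ψ := fun y => τ (v n y)) (η := fun y => σ (v' n y))
        (hτ.contDiff.comp (hv n).1) (hσ.contDiff.comp (hv' n).1), pderiv_comp hτ.contDiff (hv n).1, pderiv_comp hσ.contDiff (hv' n).1]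
      ring
    simp_rw [e]
    refine tendsto_L1_comp_add
      (fun n => (mp n j _).mul (meas cτ' cσ (mv n _) (mv' n _)))
      ((hu.integrable_grad j).1.mul (meas cτ' cσ mu mw)) ?_ ?_
    · exact tendsto_L1_mul_bdd (mp · j _) (hu.integrable_grad j) (h2 j)
        (fun n => meas cτ' cσ (mv n _) (mv' n _)) (meas cτ' cσ mu mw)
        (fun n => Eventually.of_forall fun x => b2 _ _) (lim cτ' cσ h4 h4')
    · exact tendsto_L1_mul_bdd (mp' · j _) (hw.integrable_grad j) (h2' j)
        (fun n => meas cτ cσ' (mv n _) (mv' n _)) (meas cτ cσ' mu mw)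
        (fun n => Eventually.of_forall fun x => b3 _ _) (lim cτ cσ' h4 h4')
  · exact bdd (fun n => meas cτ cσ (mv n _) (mv' n _)) (meas cτ cσ mg mh) (fun n x => b1 _ _)
      (lim cτ cσ h5 h5')

/-- Integration by parts for a truncated function and an arbitrary one, as soon as the product
`∂u/∂xⱼ w` is integrable: the truncation of `w` is removed by dominated convergence. -/
lemma integral_trunc_mul (hB : IsRegularBody B N) (hu : HasGradTrace B u D g)
    (hw : HasGradTrace B w E h) {τ : ℝ → ℝ} (hτ : IsTruncation τ) (j : Fin 3)
    (hDw : IntegrableOn (fun x => D j x * w x) B) :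
    (∫ x in B, D j x * w x * deriv τ (u x)) + ∫ x in B, E j x * τ (u x) =
      ∫ x, τ (g x) * h x * N x j ∂(surf B) := by
  obtain ⟨C, hC⟩ := hτ.bounded
  have cτ := hτ.contDiff.continuous
  have cτ' := hτ.continuous_deriv
  have mu := hu.integrable.1
  have mw := hw.integrable.1
  have mg := hu.integrable_trace.1
  have mh := hw.integrable_trace.1
  have mτu := cτ.comp_aestronglyMeasurable mu
  have mτu' := cτ'.comp_aestronglyMeasurable mu
  have mτg := cτ.comp_aestronglyMeasurable mg
  rw [← integral_add (hDw.mul_bdd mτu' (Eventually.of_forall fun x => hτ.abs_deriv_le _))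
    ((hw.integrable_grad j).mul_bdd mτu (Eventually.of_forall fun x => hC _))]
  have hσ := isTruncation_arctanTrunc
  have e (n : ℕ) := (trunc_mul_trunc hB hu hw hτ (hσ n)).integral_grad hB j
  have mσ {μ : Measure Space} {f : Space → ℝ} (n : ℕ) (hf : AEStronglyMeasurable f μ) :=
    (hσ n).contDiff.continuous.comp_aestronglyMeasurable hf
  have mσ' {μ : Measure Space} {f : Space → ℝ} (n : ℕ) (hf : AEStronglyMeasurable f μ) :=
    (hσ n).continuous_deriv.comp_aestronglyMeasurable hf
  have l1 := tendsto_integral_of_dominated_convergence (μ := volume.restrict B)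
    (F := fun n x => D j x * (deriv τ (u x) * arctanTrunc n (w x)) +
      E j x * (τ (u x) * deriv (arctanTrunc n) (w x)))
    (f := fun x => D j x * w x * deriv τ (u x) + E j x * τ (u x))
    (fun x => |D j x * w x| + |E j x| * C)
    (fun n => ((hu.integrable_grad j).1.mul (mτu'.mul (mσ n mw))).add
      ((hw.integrable_grad j).1.mul (mτu.mul (mσ' n mw))))
    (hDw.abs.add ((hw.integrable_grad j).abs.mul_const C))
    (fun n => Eventually.of_forall fun x => by
      refine (norm_add_le _ _).trans (add_le_add ?_ ?_)
      · rw [Real.norm_eq_abs, abs_mul, abs_mul, abs_mul]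
        refine mul_le_mul_of_nonneg_left ?_ (abs_nonneg _)
        rw [← one_mul |w x|]
        exact mul_le_mul (hτ.abs_deriv_le _) ((hσ n).abs_le _) (abs_nonneg _) zero_le_one
      · rw [Real.norm_eq_abs, abs_mul, abs_mul]
        refine mul_le_mul_of_nonneg_left ?_ (abs_nonneg _)
        rw [← mul_one C]
        exact mul_le_mul (hC _) ((hσ n).abs_deriv_le _) (abs_nonneg _)
          ((abs_nonneg _).trans (hC 0)))
    (Eventually.of_forall fun x => by
      have := (((tendsto_arctanTrunc (w x)).const_mul (deriv τ (u x))).const_mul (D j x)).add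
        (((tendsto_deriv_arctanTrunc (w x)).const_mul (τ (u x))).const_mul (E j x))
      rwa [mul_one, mul_comm (deriv τ (u x)), ← mul_assoc] at this)
  have l2 := tendsto_integral_of_dominated_convergence (μ := surf B)
    (F := fun n x => τ (g x) * arctanTrunc n (h x) * N x j)
    (f := fun x => τ (g x) * h x * N x j) (fun x => C * |h x|)
    (fun n => (mτg.mul (mσ n mh)).mul (hB.normal_measurable j))
    (hw.integrable_trace.abs.const_mul C)
    (fun n => by
      filter_upwards [hB.abs_normal_le j] with x hx
      rw [Real.norm_eq_abs, abs_mul, abs_mul, ← mul_one (C * _)]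
      have hC0 : 0 ≤ C := (abs_nonneg _).trans (hC 0)
      exact mul_le_mul (mul_le_mul (hC _) ((hσ n).abs_le _) (abs_nonneg _) hC0) hx
        (abs_nonneg _) (by positivity))
    (Eventually.of_forall fun x => ((tendsto_arctanTrunc (h x)).const_mul _).mul_const _)
  exact tendsto_nhds_unique l1 (l2.congr fun n => (e n).symm)

/-- The principle of virtual work for a scalar `u ∈ W^{1,1}(B)` vanishing on `Sx` and a
divergence-free `W^{1,1}` field `S` with normal component `s` on the rest of the boundary. Since `u`
and `S` are both unbounded, the formula is first proved for truncations of `u`: their products with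
`div S` are integrable and vanish, and the truncations then tend to `u`. -/
lemma integral_grad_mul {Sx : Set Space} (hSx : MeasurableSet Sx) (hB : IsRegularBody B N)
    (hu : HasGradTrace B u D g) {S : Fin 3 → Space → ℝ} {E : Fin 3 → Fin 3 → Space → ℝ}
    {h : Fin 3 → Space → ℝ} (hS : ∀ j, HasGradTrace B (S j) (E j) (h j)) {s : Space → ℝ}
    (hdiv : ∀ᵐ x ∂(volume.restrict B), ∑ j, E j j x = 0)
    (hg : ∀ᵐ x ∂((surf B).restrict Sx), g x = 0)
    (hs : ∀ᵐ x ∂((surf B).restrict (tractionBoundary B Sx)), ∑ j, h j x * N x j = s x)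
    (hDS : ∀ j, IntegrableOn (fun x => D j x * S j x) B)
    (hgs : Integrable (fun x => g x * s x) ((surf B).restrict (tractionBoundary B Sx))) :
    ∫ x in B, ∑ j, D j x * S j x =
      ∫ x, g x * s x ∂((surf B).restrict (tractionBoundary B Sx)) := by
  have hσ := isTruncation_arctanTrunc
  have mu := hu.integrable.1
  have mg := hu.integrable_trace.1
  have mσ {μ : Measure Space} {f : Space → ℝ} (n : ℕ) (hf : AEStronglyMeasurable f μ) :=
    (hσ n).contDiff.continuous.comp_aestronglyMeasurable hf
  have mσ' {μ : Measure Space} {f : Space → ℝ} (n : ℕ) (hf : AEStronglyMeasurable f μ) :=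
    (hσ n).continuous_deriv.comp_aestronglyMeasurable hf
  have hSum : IntegrableOn (fun x => ∑ j, D j x * S j x) B :=
    integrable_finsetSum _ fun j _ => hDS j
  have hset : (surf B).restrict (tractionBoundary B Sx) = (surf B).restrict Sxᶜ := by
    unfold surf tractionBoundary
    rw [Measure.restrict_restrict (measurableSet_frontier.diff hSx), Measure.restrict_restrict hSx.compl]
    congr 1
    ext x
    simp only [mem_inter_iff, Set.mem_sdiff, mem_compl_iff]
    tauto
  have key (n : ℕ) : ∫ x in B, (∑ j, D j x * S j x) * deriv (arctanTrunc n) (u x) =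
      ∫ x, arctanTrunc n (g x) * s x ∂((surf B).restrict (tractionBoundary B Sx)) := by
    obtain ⟨C, hC⟩ := (hσ n).bounded
    have hi1 (j : Fin 3) : IntegrableOn (fun x => D j x * S j x * deriv (arctanTrunc n) (u x)) B :=
      (hDS j).mul_bdd (mσ' n mu) (Eventually.of_forall fun x => (hσ n).abs_deriv_le _)
    have hi2 (j : Fin 3) : IntegrableOn (fun x => E j j x * arctanTrunc n (u x)) B :=
      ((hS j).integrable_grad j).mul_bdd (mσ n mu) (Eventually.of_forall fun x => hC _)
    have hi3 (j : Fin 3) : Integrable (fun x => arctanTrunc n (g x) * h j x * N x j) (surf B) :=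
      ((hS j).integrable_trace.bdd_mul (mσ n mg) (Eventually.of_forall fun x => hC _)).mul_bdd
        (hB.normal_measurable j) (hB.abs_normal_le j)
    have e := Finset.sum_congr rfl fun j (_ : j ∈ Finset.univ) =>
      hu.integral_trunc_mul hB (hS j) (hσ n) j (hDS j)
    rw [Finset.sum_add_distrib, ← integral_finsetSum _ fun j _ => hi1 j,
      ← integral_finsetSum _ fun j _ => hi2 j, ← integral_finsetSum _ fun j _ => hi3 j] at e
    have e2 : ∫ x in B, ∑ j, E j j x * arctanTrunc n (u x) = 0 := by
      rw [← integral_zero Space ℝ (μ := volume.restrict B)]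
      refine integral_congr_ae ?_
      filter_upwards [hdiv] with x hx
      rw [← Finset.sum_mul, hx, zero_mul]
    rw [e2, add_zero] at e
    simp_rw [Finset.sum_mul]
    rw [e, ← integral_add_compl hSx (integrable_finsetSum _ fun j _ => hi3 j), hset]
    rw [hset] at hs
    have e3 : ∫ x in Sx, ∑ j, arctanTrunc n (g x) * h j x * N x j ∂(surf B) = 0 := by
      rw [← integral_zero Space ℝ (μ := (surf B).restrict Sx)]
      refine integral_congr_ae ?_
      filter_upwards [hg] with x hx
      simp [hx, (hσ n).map_zero]
    rw [e3, zero_add]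
    refine integral_congr_ae ?_
    filter_upwards [hs] with x hx
    simp_rw [mul_assoc]
    rw [← Finset.mul_sum, hx]
  have ms : AEStronglyMeasurable s ((surf B).restrict (tractionBoundary B Sx)) :=
    (Finset.aestronglyMeasurable_fun_sum Finset.univ fun j _ =>
      ((hS j).integrable_trace.1.restrict.mul (hB.normal_measurable j).restrict)).congr hs
  have l1 := tendsto_integral_of_dominated_convergence (μ := volume.restrict B)
    (F := fun n x => (∑ j, D j x * S j x) * deriv (arctanTrunc n) (u x))
    (f := fun x => ∑ j, D j x * S j x) (fun x => |∑ j, D j x * S j x|)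
    (fun n => hSum.1.mul (mσ' n mu)) hSum.abs
    (fun n => Eventually.of_forall fun x => by
      rw [Real.norm_eq_abs, abs_mul]
      exact mul_le_of_le_one_right (abs_nonneg _) ((hσ n).abs_deriv_le _))
    (Eventually.of_forall fun x => by
      simpa using (tendsto_deriv_arctanTrunc (u x)).const_mul (∑ j, D j x * S j x))
  have l2 := tendsto_integral_of_dominated_convergence
    (μ := (surf B).restrict (tractionBoundary B Sx))
    (F := fun n x => arctanTrunc n (g x) * s x)
    (f := fun x => g x * s x) (fun x => |g x * s x|)
    (fun n => (mσ n mg.restrict).mul ms) hgs.abs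
    (fun n => Eventually.of_forall fun x => by
      rw [Real.norm_eq_abs, abs_mul, abs_mul]
      exact mul_le_mul_of_nonneg_right ((hσ n).abs_le _) (abs_nonneg _))
    (Eventually.of_forall fun x => (tendsto_arctanTrunc (g x)).mul_const _)
  exact tendsto_nhds_unique l1 (l2.congr fun n => (key n).symm)

end HasGradTrace

/-! ### Weak gradients and traces of `W^{1,1}` functions -/

lemma IsWeakPartial.ae_eq {B : Set Space} (hB : IsOpen B) {j : Fin 3} {u D D' : Space → ℝ}
    (h : IsWeakPartial B j u D) (h' : IsWeakPartial B j u D') : D =ᵐ[volume.restrict B] D' := by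
  have hi : IntegrableOn (fun x => D x - D' x) B := h.1.sub h'.1
  have key := hB.ae_eq_zero_of_integral_contDiff_smul_eq_zero (μ := volume)
    hi.locallyIntegrableOn fun ψ hψ hψc hψB => by
      obtain ⟨C, hC⟩ := hψ.continuous.bounded_above_of_compact_support hψc
      have hm : AEStronglyMeasurable ψ (volume.restrict B) := hψ.continuous.aestronglyMeasurable
      have e := (h.2 ψ hψ hψc hψB).symm.trans (h'.2 ψ hψ hψc hψB)
      rw [← setIntegral_eq_integral_of_forall_compl_eq_zero (s := B) fun x hx => by
        rw [image_eq_zero_of_notMem_tsupport fun hx' => hx (hψB hx'), zero_smul]]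
      simp_rw [smul_eq_mul, mul_comm (ψ _), sub_mul]
      rw [integral_sub (h.1.mul_bdd hm (Eventually.of_forall hC))
        (h'.1.mul_bdd hm (Eventually.of_forall hC))]
      linarith
  rw [EventuallyEq, ae_restrict_iff' hB.measurableSet]
  filter_upwards [key] with x hx hxB
  linarith [hx hxB]

lemma isWeakPartial_weakPartial {B : Set Space} {j : Fin 3} {u : Space → ℝ}
    (h : ∃ D, IsWeakPartial B j u D) : IsWeakPartial B j u (weakPartial B j u) := by
  rw [weakPartial, dif_pos h]
  exact h.choose_spec

lemma IsTrace.hasGradTrace {B : Set Space} {u g : Space → ℝ} (hg : IsTrace B u g)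
    (hu : MemW11 B u) : HasGradTrace B u (fun j => weakPartial B j u) g :=
  ⟨hu.1, fun j => (isWeakPartial_weakPartial (hu.2 j)).1, hg.1, hg.2⟩

lemma hasGradTrace_trace {B : Set Space} {u : Space → ℝ} (hu : MemW11 B u)
    (h : ∃ g, IsTrace B u g) : HasGradTrace B u (fun j => weakPartial B j u) (trace B u) := by
  refine IsTrace.hasGradTrace ?_ hu
  rw [trace, dif_pos h]
  exact h.choose_spec

namespace HasGradTrace

variable {B : Set Space} {N : Space → Vec} {u : Space → ℝ} {D D' : Fin 3 → Space → ℝ}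
  {g g' : Space → ℝ}

lemma integral_mul_smooth (hB : IsRegularBody B N) (hu : HasGradTrace B u D g) {ψ : Space → ℝ}
    (hψ : ContDiff ℝ 1 ψ) (hψc : HasCompactSupport ψ) (j : Fin 3) :
    (∫ x in B, D j x * ψ x) + ∫ x in B, u x * pderiv j ψ x =
      ∫ x, g x * ψ x * N x j ∂(surf B) := by
  obtain ⟨C, hC⟩ := hψ.continuous.bounded_above_of_compact_support hψc
  obtain ⟨C', hC'⟩ := (continuous_pderiv hψ j).bounded_above_of_compact_support
    (hψc.fderiv_apply ℝ _)
  rw [← (hu.mul_smooth hψ hψc).integral_grad hB j, integral_add]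
  · exact (hu.integrable_grad j).mul_bdd hψ.continuous.aestronglyMeasurable
      (Eventually.of_forall hC)
  · exact hu.integrable.mul_bdd (continuous_pderiv hψ j).aestronglyMeasurable
      (Eventually.of_forall hC')

lemma isWeakPartial (hB : IsRegularBody B N) (hu : HasGradTrace B u D g) (j : Fin 3) :
    IsWeakPartial B j u (D j) := by
  refine ⟨hu.integrable_grad j, fun ψ hψ hψc hψB => ?_⟩
  have e := hu.integral_mul_smooth hB (hψ.of_le (by simp)) hψc j
  have e0 : ∫ x, g x * ψ x * N x j ∂(surf B) = 0 := by
    refine setIntegral_eq_zero_of_forall_eq_zero fun x hx => ?_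
    rw [hB.isOpen.frontier_eq] at hx
    rw [image_eq_zero_of_notMem_tsupport fun hx' => hx.2 (hψB hx'), mul_zero, zero_mul]
  linarith

lemma weakPartial_ae_eq (hB : IsRegularBody B N) (hu : HasGradTrace B u D g) (j : Fin 3) :
    weakPartial B j u =ᵐ[volume.restrict B] D j :=
  (isWeakPartial_weakPartial ⟨_, hu.isWeakPartial hB j⟩).ae_eq hB.isOpen (hu.isWeakPartial hB j)

lemma memW11 (hB : IsRegularBody B N) (hu : HasGradTrace B u D g) : MemW11 B u :=
  ⟨hu.integrable, fun j => ⟨_, hu.isWeakPartial hB j⟩⟩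

lemma isTrace (hB : IsRegularBody B N) (hu : HasGradTrace B u D g) : IsTrace B u g := by
  obtain ⟨v, hv, h1, h2, h3⟩ := hu.approx
  refine ⟨hu.integrable_trace, v, hv, h1, fun j => (h2 j).congr fun n => ?_, h3⟩
  refine lintegral_congr_ae ?_
  filter_upwards [hu.weakPartial_ae_eq hB j] with x hx
  rw [hx]

/-- Boundary values are unique: by the divergence theorem the difference of two of them, multiplied
by a component of the unit normal, annihilates all test functions. -/
lemma trace_unique (hB : IsRegularBody B N) (hu : HasGradTrace B u D g)
    (hu' : HasGradTrace B u D' g') : g =ᵐ[surf B] g' := by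
  have := hB.isFiniteMeasure_surf
  have hg := hu.integrable_trace.sub hu'.integrable_trace
  have key (j : Fin 3) : ∀ᵐ x ∂(surf B), (g x - g' x) * N x j = 0 := by
    have hi : Integrable (fun x => (g x - g' x) * N x j) (surf B) :=
      hg.mul_bdd (hB.normal_measurable j) (hB.abs_normal_le j)
    refine ae_eq_zero_of_integral_contDiff_smul_eq_zero hi.locallyIntegrable fun ψ hψ hψc => ?_
    obtain ⟨C, hC⟩ := hψ.continuous.bounded_above_of_compact_support hψc
    have hψ1 : ContDiff ℝ 1 ψ := hψ.of_le (by simp)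
    have hm : AEStronglyMeasurable ψ (surf B) := hψ.continuous.aestronglyMeasurable
    have e := hu.integral_mul_smooth hB hψ1 hψc j
    have e' := hu'.integral_mul_smooth hB hψ1 hψc j
    have eD : ∫ x in B, D j x * ψ x = ∫ x in B, D' j x * ψ x := by
      refine integral_congr_ae ?_
      filter_upwards [(hu.isWeakPartial hB j).ae_eq hB.isOpen (hu'.isWeakPartial hB j)] with x hx
      rw [hx]
    have es : ∫ x, ψ x • ((g x - g' x) * N x j) ∂(surf B) =
        ∫ x, g x * ψ x * N x j - g' x * ψ x * N x j ∂(surf B) :=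
      integral_congr_ae (Eventually.of_forall fun x => by simp only [smul_eq_mul]; ring)
    rw [es, integral_sub, ← e, ← e', eD, sub_self]
    · exact (hu.integrable_trace.mul_bdd hm (Eventually.of_forall hC)).mul_bdd
        (hB.normal_measurable j) (hB.abs_normal_le j)
    · exact (hu'.integrable_trace.mul_bdd hm (Eventually.of_forall hC)).mul_bdd
        (hB.normal_measurable j) (hB.abs_normal_le j)
  filter_upwards [ae_all_iff.2 key, hB.normal_unit] with x hx hN
  have : (g x - g' x) * (N x ⬝ᵥ N x) = 0 := by
    rw [dotProduct, Finset.mul_sum]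
    exact Finset.sum_eq_zero fun j _ => by rw [← mul_assoc, hx j, zero_mul]
  rw [hN, mul_one] at this
  linarith

lemma trace_ae_eq (hB : IsRegularBody B N) (hu : HasGradTrace B u D g) :
    trace B u =ᵐ[surf B] g :=
  (hasGradTrace_trace (hu.memW11 hB) ⟨g, hu.isTrace hB⟩).trace_unique hB hu

/-- A `C¹` function, cut off away from `B`, has its classical gradient and boundary values. -/
lemma of_contDiff (hB : IsRegularBody B N) {φ : Space → ℝ} (hφ : ContDiff ℝ 1 φ) :
    HasGradTrace B φ (fun j => pderiv j φ) φ := by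
  have := hB.isFiniteMeasure_surf
  obtain ⟨r, hr, hBr⟩ := hB.isBounded.subset_ball_lt 0 (0 : Space)
  let b : ContDiffBump (0 : Space) := ⟨r + 1, r + 2, by linarith, by linarith⟩
  have hcl : closure B ⊆ Metric.ball 0 (r + 1) :=
    (closure_mono hBr).trans (Metric.closure_ball_subset_closedBall.trans
      (Metric.closedBall_subset_ball (by linarith)))
  have hb1 : ∀ x ∈ closure B, (fun y => b y * φ y) =ᶠ[𝓝 x] φ := fun x hx => by
    filter_upwards [b.eventuallyEq_one_of_mem_ball (hcl hx)] with y hy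
    simp [hy]
  have hvC : ContDiff ℝ 1 fun y => b y * φ y := b.contDiff.mul hφ
  have hvc : HasCompactSupport fun y => b y * φ y := b.hasCompactSupport.mul_right
  have hcpt : IsCompact (closure B) := hB.isBounded.isCompact_closure
  have hint {f : Space → ℝ} (hf : Continuous f) : IntegrableOn f B :=
    (hf.continuousOn.integrableOn_compact hcpt).mono_set subset_closure
  have hsurf : ∀ᵐ x ∂(surf B), b x * φ x = φ x := by
    unfold surf
    rw [ae_restrict_iff' measurableSet_frontier]
    exact Eventually.of_forall fun x hx => (hb1 x (frontier_subset_closure hx)).eq_of_nhds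
  have hsi : Integrable φ (surf B) :=
    (hvC.continuous.integrable_of_hasCompactSupport hvc).congr hsurf
  refine ⟨hint hφ.continuous, fun j => hint (continuous_pderiv hφ j), hsi,
    fun _ y => b y * φ y, fun _ => ⟨hvC, hvc⟩, ?_, fun j => ?_, ?_⟩
  · have e : ∫⁻ x in B, ‖b x * φ x - φ x‖ₑ = 0 := by
      rw [setLIntegral_congr_fun hB.isOpen.measurableSet (g := fun _ => 0) fun x hx => by
        simp [(hb1 x (subset_closure hx)).eq_of_nhds]]
      exact lintegral_zero
    simp_rw [e]
    exact tendsto_const_nhds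
  · have e : ∫⁻ x in B, ‖pderiv j (fun y => b y * φ y) x - pderiv j φ x‖ₑ = 0 := by
      rw [setLIntegral_congr_fun hB.isOpen.measurableSet (g := fun _ => 0) fun x hx => by
        simp [pderiv, (hb1 x (subset_closure hx)).fderiv_eq]]
      exact lintegral_zero
    simp_rw [e]
    exact tendsto_const_nhds
  · have e : ∫⁻ x, ‖b x * φ x - φ x‖ₑ ∂(surf B) = 0 := by
      rw [← lintegral_zero (μ := surf B)]
      refine lintegral_congr_ae ?_
      filter_upwards [hsurf] with x hx
      simp [hx]
    simp_rw [e]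
    exact tendsto_const_nhds

end HasGradTrace

/-! ### Variations and rotations of admissible deformations -/

section Elastic

variable {B Sx : Set Space} {N : Space → Vec} {t : Space → Vec} {V : ℝ → ℝ} {p : ℝ≥0∞}
  {T : Space → Mat} {χ φ : Space → Vec} {R : Mat}

lemma GeomAdmissible.hasGradTrace (hχ : GeomAdmissible B Sx χ) (i : Fin 3) :
    HasGradTrace B (fun x => χ x i) (fun j x => grad B χ x i j) (fun x => traceVec B χ x i) :=
  hasGradTrace_trace (hχ i).1 (hχ i).2.1

lemma StatAdmissible.hasGradTrace (hT : StatAdmissible B N Sx t T) (i j : Fin 3) :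
    HasGradTrace B (fun x => T x i j) (fun k => weakPartial B k fun y => T y i j)
      (trace B fun y => T y i j) :=
  hasGradTrace_trace (hT.1 i j).1 (hT.1 i j).2

lemma IsVariation.hasGradTrace (hB : IsRegularBody B N) (hφ : IsVariation B Sx φ) (i : Fin 3) :
    HasGradTrace B (fun x => φ x i) (fun j => pderiv j fun x => φ x i) (fun x => φ x i) :=
  .of_contDiff hB (contDiff_pi.1 (hφ.1.of_le one_le_two) i)

lemma grad_ae_eq (hB : IsRegularBody B N) {D : Fin 3 → Fin 3 → Space → ℝ}
    {g : Fin 3 → Space → ℝ} (h : ∀ i, HasGradTrace B (fun x => χ x i) (D i) (g i)) :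
    ∀ᵐ x ∂(volume.restrict B), grad B χ x = Matrix.of fun i j => D i j x := by
  filter_upwards [ae_all_iff.2 fun i => ae_all_iff.2 fun j => (h i).weakPartial_ae_eq hB j]
    with x hx
  ext i j
  exact hx i j

lemma traceVec_ae_eq (hB : IsRegularBody B N) {D : Fin 3 → Fin 3 → Space → ℝ}
    {g : Fin 3 → Space → ℝ} (h : ∀ i, HasGradTrace B (fun x => χ x i) (D i) (g i)) :
    ∀ᵐ x ∂(surf B), traceVec B χ x = fun i => g i x := by
  filter_upwards [ae_all_iff.2 fun i => (h i).trace_ae_eq hB] with x hx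
  ext i
  exact hx i

lemma trace_transpose_mul (F S : Mat) : (Fᵀ * S).trace = ∑ i, ∑ j, F i j * S i j := by
  simp only [Matrix.trace, Matrix.diag, Matrix.mul_apply, Matrix.transpose_apply]
  exact Finset.sum_comm

lemma FiniteStressWork.integrable {F : Space → Mat} (h : FiniteStressWork B T F) :
    IntegrableOn (fun x => ((F x)ᵀ * T x).trace) B := by
  simp_rw [trace_transpose_mul]
  exact integrable_finsetSum _ fun i _ => integrable_finsetSum _ fun j _ => h i j i j

lemma StatAdmissible.integrable_traction (hB : IsRegularBody B N)
    (hT : StatAdmissible B N Sx t T) (i : Fin 3) :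
    Integrable (fun x => t x i) ((surf B).restrict (tractionBoundary B Sx)) := by
  refine Integrable.congr ?_ (hT.2.2 i)
  exact integrable_finsetSum _ fun j _ => ((hT.hasGradTrace i j).integrable_trace.mul_bdd
    (hB.normal_measurable j) (hB.abs_normal_le j)).restrict

lemma bounded_of_continuous (hB : IsRegularBody B N) {f : Space → ℝ} (hf : Continuous f) :
    ∃ C, ∀ x ∈ closure B, ‖f x‖ ≤ C :=
  hB.isBounded.isCompact_closure.exists_bound_of_continuousOn hf.continuousOn

/-- The principle of virtual work for a variation. -/
lemma IsVariation.virtual_work (hB : IsRegularBody B N) (hSx : MeasurableSet Sx)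
    (hφ : IsVariation B Sx φ) (hT : StatAdmissible B N Sx t T) :
    IntegrableOn (fun x => ∑ i, ∑ j, pderiv j (fun y => φ y i) x * T x i j) B ∧
      Integrable (fun x => φ x ⬝ᵥ t x) ((surf B).restrict (tractionBoundary B Sx)) ∧
      ∫ x in B, ∑ i, ∑ j, pderiv j (fun y => φ y i) x * T x i j =
        ∫ x, φ x ⬝ᵥ t x ∂((surf B).restrict (tractionBoundary B Sx)) := by
  have hC1 (i : Fin 3) : ContDiff ℝ 1 fun x => φ x i := contDiff_pi.1 (hφ.1.of_le one_le_two) i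
  have h1 (i j : Fin 3) : IntegrableOn (fun x => pderiv j (fun y => φ y i) x * T x i j) B := by
    obtain ⟨C, hC⟩ := bounded_of_continuous hB (continuous_pderiv (hC1 i) j)
    refine (hT.hasGradTrace i j).integrable.bdd_mul
      (continuous_pderiv (hC1 i) j).aestronglyMeasurable
      (ae_restrict_of_forall_mem hB.isOpen.measurableSet fun x hx => hC x (subset_closure hx))
  have h2 (i : Fin 3) : Integrable (fun x => φ x i * t x i)
      ((surf B).restrict (tractionBoundary B Sx)) := by
    obtain ⟨C, hC⟩ := bounded_of_continuous hB (hC1 i).continuous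
    refine (hT.integrable_traction hB i).bdd_mul (c := C)
      (hC1 i).continuous.aestronglyMeasurable (ae_restrict_of_ae ?_)
    exact ae_restrict_of_forall_mem measurableSet_frontier fun x hx =>
      hC x (frontier_subset_closure hx)
  refine ⟨integrable_finsetSum _ fun i _ => integrable_finsetSum _ fun j _ => h1 i j,
    integrable_finsetSum _ fun i _ => h2 i, ?_⟩
  simp only [dotProduct]
  rw [integral_finsetSum _ fun i _ => integrable_finsetSum _ fun j _ => h1 i j,
    integral_finsetSum _ fun i _ => h2 i]
  refine Finset.sum_congr rfl fun i _ => ?_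
  refine (hφ.hasGradTrace hB i).integral_grad_mul hSx hB (fun j => hT.hasGradTrace i j)
    (hT.2.1 i) ?_ (hT.2.2 i) (h1 i) (h2 i)
  filter_upwards [hφ.2] with x hx
  simp [hx]

/-- On admissible deformations, `Π` and `Π_T` differ by the stress work minus the work of the
traction. -/
lemma totalPotential_sub_canonicalPotential (hχ : KinAdmissible B Sx t V p χ)
    (hF : FiniteStressWork B T (grad B χ)) :
    totalPotential B Sx t V χ = canonicalPotential B V T (grad B χ) +
      ((∫ x in B, ((grad B χ x)ᵀ * T x).trace) -
        ∫ x, traceVec B χ x ⬝ᵥ t x ∂((surf B).restrict (tractionBoundary B Sx))) := by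
  unfold totalPotential canonicalPotential G
  rw [integral_sub hχ.2.2.2.1 hF.integrable]
  ring

lemma IsStationaryPT.isStationaryP (hB : IsRegularBody B N) (hSx : MeasurableSet Sx)
    (hT : StatAdmissible B N Sx t T) (hχ : IsStationaryPT B Sx t V p T χ) :
    IsStationaryP B Sx t V p χ := by
  obtain ⟨⟨hA, hF⟩, hst⟩ := hχ
  refine ⟨hA, fun φ hφ => ⟨(hst φ hφ).1.mono fun s hs => hs.1, ?_⟩⟩
  obtain ⟨i1, i2, hvw⟩ := hφ.virtual_work hB hSx hT
  have hsum (s : ℝ) (i : Fin 3) : HasGradTrace B (fun x => (χ + s • φ) x i)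
      (fun j x => grad B χ x i j + s * pderiv j (fun y => φ y i) x)
      (fun x => traceVec B χ x i + s * φ x i) :=
    (hA.1.hasGradTrace i).add ((hφ.hasGradTrace hB i).const_mul s)
  refine ((hst φ hφ).2.add_const ((∫ x in B, ((grad B χ x)ᵀ * T x).trace) -
    ∫ x, traceVec B χ x ⬝ᵥ t x ∂((surf B).restrict (tractionBoundary B Sx)))).congr_of_eventuallyEq ?_
  filter_upwards [(hst φ hφ).1] with s hs
  rw [totalPotential_sub_canonicalPotential hs.1 hs.2]
  congr 1
  have e1 : ∫ x in B, ((grad B (χ + s • φ) x)ᵀ * T x).trace =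
      (∫ x in B, ((grad B χ x)ᵀ * T x).trace) +
        s * ∫ x in B, ∑ i, ∑ j, pderiv j (fun y => φ y i) x * T x i j := by
    rw [← integral_const_mul, ← integral_add hF.integrable (i1.const_mul s)]
    refine integral_congr_ae ?_
    filter_upwards [grad_ae_eq hB (hsum s)] with x hx
    rw [hx]
    simp only [trace_transpose_mul, Matrix.of_apply, add_mul, Finset.sum_add_distrib,
      Finset.mul_sum, mul_assoc]
  have e2 : ∫ x, traceVec B (χ + s • φ) x ⬝ᵥ t x ∂((surf B).restrict (tractionBoundary B Sx)) =
      (∫ x, traceVec B χ x ⬝ᵥ t x ∂((surf B).restrict (tractionBoundary B Sx))) +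
        s * ∫ x, φ x ⬝ᵥ t x ∂((surf B).restrict (tractionBoundary B Sx)) := by
    rw [← integral_const_mul, ← integral_add hA.2.2.2.2 (i2.const_mul s)]
    refine integral_congr_ae ?_
    filter_upwards [ae_restrict_of_ae (traceVec_ae_eq hB (hsum s))] with x hx
    rw [hx]
    simp only [dotProduct, add_mul, Finset.sum_add_distrib, Finset.mul_sum, mul_assoc]
  rw [e1, e2, hvw]
  ring

lemma transpose_mul_self_of_mem (hR : R ∈ Matrix.specialOrthogonalGroup (Fin 3) ℝ) :
    Rᵀ * R = 1 :=
  (Matrix.mem_orthogonalGroup_iff' _ _).1 (Matrix.mem_specialOrthogonalGroup_iff.1 hR).1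

lemma self_mul_transpose_of_mem (hR : R ∈ Matrix.specialOrthogonalGroup (Fin 3) ℝ) :
    R * Rᵀ = 1 :=
  (Matrix.mem_orthogonalGroup_iff _ _).1 (Matrix.mem_specialOrthogonalGroup_iff.1 hR).1

/-- The objectivity of `Λ`. -/
lemma strain_mul (hR : R ∈ Matrix.specialOrthogonalGroup (Fin 3) ℝ) (F : Mat) :
    strain (R * F) = strain F := by
  unfold strain
  rw [Matrix.transpose_mul, Matrix.mul_assoc, ← Matrix.mul_assoc Rᵀ, transpose_mul_self_of_mem hR,
    Matrix.one_mul]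

/-- The rotated stress `RᵀT` balances the same traction, so `T - RᵀT` is divergence-free with zero
traction, and its work on `∇χ` vanishes. -/
lemma canonicalPotential_rotation (hB : IsRegularBody B N) (hSx : MeasurableSet Sx)
    (hT : StatAdmissible B N Sx t T) {R : Space → Mat} (hR : IsRotationField B R)
    (hRT : StatAdmissible B N Sx t fun x => (R x)ᵀ * T x) (hχ : KinAdmissible B Sx t V p χ)
    (hF : FiniteStressWork B T (grad B χ)) :
    canonicalPotential B V T (grad B χ) =
      canonicalPotential B V T fun x => R x * grad B χ x := by
  have hentry (i j : Fin 3) : ∀ᵐ x ∂(volume.restrict B), ‖R x i j‖ ≤ 1 :=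
    ae_restrict_of_forall_mem hB.isOpen.measurableSet fun x hx =>
      entry_norm_bound_of_unitary (Matrix.mem_specialOrthogonalGroup_iff.1 (hR.2 x hx)).1 i j
  have hF' : FiniteStressWork B (fun x => (R x)ᵀ * T x) (grad B χ) := fun i j k l => by
    have : (fun x => grad B χ x i j * ((R x)ᵀ * T x) k l) =
        fun x => ∑ m, R x m k * (grad B χ x i j * T x m l) := by
      ext x
      rw [Matrix.mul_apply, Finset.mul_sum]
      exact Finset.sum_congr rfl fun m _ => by rw [Matrix.transpose_apply]; ring
    rw [this]
    exact integrable_finsetSum _ fun m _ => (hF i j m l).bdd_mul (hR.1 m k).1 (hentry m k)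
  have hwork : ∫ x in B, ((grad B χ x)ᵀ * T x).trace =
      ∫ x in B, ((grad B χ x)ᵀ * ((R x)ᵀ * T x)).trace := by
    rw [← sub_eq_zero, ← integral_sub hF.integrable hF'.integrable]
    have hD (i j : Fin 3) : IntegrableOn
        (fun x => grad B χ x i j * (T x i j + (-1) * ((R x)ᵀ * T x) i j)) B := by
      refine ((hF i j i j).sub (hF' i j i j)).congr (Eventually.of_forall fun x => ?_)
      simp only [Pi.sub_apply]
      ring
    have hrow (i : Fin 3) : ∫ x in B, ∑ j, grad B χ x i j *
        (T x i j + (-1) * ((R x)ᵀ * T x) i j) = 0 := by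
      have h := (hχ.1.hasGradTrace i).integral_grad_mul hSx hB (s := fun _ => 0)
        (fun j => (hT.hasGradTrace i j).add ((hRT.hasGradTrace i j).const_mul (-1))) ?_ ?_ ?_
        (hD i) (by simp)
      · simpa only [mul_zero, integral_zero] using h
      · filter_upwards [hT.2.1 i, hRT.2.1 i] with x h1 h2
        rw [Finset.sum_add_distrib, ← Finset.mul_sum, h1, h2]
        ring
      · exact (hχ.1 i).2.2
      · filter_upwards [hT.2.2 i, hRT.2.2 i] with x h1 h2
        simp only [add_mul, mul_assoc]
        rw [Finset.sum_add_distrib, ← Finset.mul_sum, h1, h2]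
        ring
    rw [← Finset.sum_eq_zero fun i (_ : i ∈ Finset.univ) => hrow i,
      ← integral_finsetSum _ fun i _ => integrable_finsetSum _ fun j _ => hD i j]
    refine integral_congr_ae (Eventually.of_forall fun x => ?_)
    simp only [trace_transpose_mul, ← Finset.sum_sub_distrib]
    refine Finset.sum_congr rfl fun i _ => Finset.sum_congr rfl fun j _ => ?_
    ring
  have e : canonicalPotential B V T (fun x => R x * grad B χ x) =
      ∫ x in B, V (strain (grad B χ x)) - ((grad B χ x)ᵀ * ((R x)ᵀ * T x)).trace := by
    refine setIntegral_congr_fun hB.isOpen.measurableSet fun x hx => ?_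
    simp only [G]
    rw [strain_mul (hR.2 x hx), Matrix.transpose_mul, Matrix.mul_assoc]
  rw [e, integral_sub hχ.2.2.2.1 hF'.integrable, ← hwork, ← integral_sub hχ.2.2.2.1 hF.integrable]
  rfl

/-- If `T` and `RᵀT` balance the same traction `t`, then `t` is invariant under `Rᵀ`. -/
lemma StatAdmissible.transpose_mulVec_traction (hB : IsRegularBody B N)
    (hT : StatAdmissible B N Sx t T) (hRT : StatAdmissible B N Sx t fun x => Rᵀ * T x) :
    ∀ᵐ x ∂((surf B).restrict (tractionBoundary B Sx)), Rᵀ *ᵥ t x = t x := by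
  have htr (i j : Fin 3) : trace B (fun y => (Rᵀ * T y) i j) =ᵐ[surf B]
      fun x => ∑ k, R k i * trace B (fun y => T y k j) x := by
    have h := HasGradTrace.sum Finset.univ fun k => (hT.hasGradTrace k j).const_mul (R k i)
    exact h.trace_ae_eq hB
  filter_upwards [ae_all_iff.2 hT.2.2, ae_all_iff.2 hRT.2.2,
    ae_restrict_of_ae (ae_all_iff.2 fun i => ae_all_iff.2 fun j => htr i j)] with x h1 h2 h3
  ext i
  rw [← h2 i]
  simp_rw [h3, Matrix.mulVec, dotProduct, Matrix.transpose_apply, ← h1, Finset.mul_sum,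
    Finset.sum_mul]
  rw [Finset.sum_comm]
  simp_rw [mul_assoc]

lemma GeomAdmissible.hasGradTrace_mulVec (hχ : GeomAdmissible B Sx χ) (i : Fin 3) :
    HasGradTrace B (fun x => (R *ᵥ χ x) i) (fun j x => (R * grad B χ x) i j)
      (fun x => (R *ᵥ traceVec B χ x) i) := by
  simp_rw [Matrix.mulVec, dotProduct, Matrix.mul_apply]
  exact HasGradTrace.sum Finset.univ fun k => (hχ.hasGradTrace k).const_mul (R i k)

lemma grad_mulVec (hB : IsRegularBody B N) (hχ : GeomAdmissible B Sx χ) :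
    ∀ᵐ x ∂(volume.restrict B), grad B (fun y => R *ᵥ χ y) x = R * grad B χ x :=
  grad_ae_eq hB hχ.hasGradTrace_mulVec

lemma traceVec_mulVec (hB : IsRegularBody B N) (hχ : GeomAdmissible B Sx χ) :
    ∀ᵐ x ∂(surf B), traceVec B (fun y => R *ᵥ χ y) x = R *ᵥ traceVec B χ x :=
  traceVec_ae_eq hB hχ.hasGradTrace_mulVec

lemma strain_grad_mulVec (hB : IsRegularBody B N)
    (hR : R ∈ Matrix.specialOrthogonalGroup (Fin 3) ℝ) (hχ : GeomAdmissible B Sx χ) :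
    ∀ᵐ x ∂(volume.restrict B),
      strain (grad B (fun y => R *ᵥ χ y) x) = strain (grad B χ x) := by
  filter_upwards [grad_mulVec (R := R) hB hχ] with x hx
  rw [hx, strain_mul hR]

lemma traction_work_mulVec (hB : IsRegularBody B N)
    (ht : ∀ᵐ x ∂((surf B).restrict (tractionBoundary B Sx)), Rᵀ *ᵥ t x = t x)
    (hχ : GeomAdmissible B Sx χ) :
    ∀ᵐ x ∂((surf B).restrict (tractionBoundary B Sx)),
      traceVec B (fun y => R *ᵥ χ y) x ⬝ᵥ t x = traceVec B χ x ⬝ᵥ t x := by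
  filter_upwards [ht, ae_restrict_of_ae (traceVec_mulVec (R := R) hB hχ)] with x h1 h2
  rw [h2, dotProduct_comm, Matrix.dotProduct_mulVec, ← Matrix.mulVec_transpose, h1,
    dotProduct_comm]

lemma KinAdmissible.mulVec (hB : IsRegularBody B N)
    (hR : R ∈ Matrix.specialOrthogonalGroup (Fin 3) ℝ)
    (ht : ∀ᵐ x ∂((surf B).restrict (tractionBoundary B Sx)), Rᵀ *ᵥ t x = t x)
    (hχ : KinAdmissible B Sx t V p χ) : KinAdmissible B Sx t V p fun x => R *ᵥ χ x := by
  obtain ⟨hG, hpos, hp, hV, hw⟩ := hχ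
  have hs := strain_grad_mulVec hB hR hG
  refine ⟨fun i => ⟨(hG.hasGradTrace_mulVec i).memW11 hB, ⟨_, (hG.hasGradTrace_mulVec i).isTrace hB⟩,
    ?_⟩, ?_, ?_, ?_, ?_⟩
  · filter_upwards [ae_all_iff.2 fun k => (hG k).2.2,
      ae_restrict_of_ae ((hG.hasGradTrace_mulVec (R := R) i).trace_ae_eq hB)] with x h1 h2
    have h0 : traceVec B χ x = 0 := funext h1
    rw [h2, h0, Matrix.mulVec_zero, Pi.zero_apply]
  · filter_upwards [hs, hpos] with x h1 h2
    rwa [h1]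
  · exact (memLp_congr_ae hs).2 hp
  · refine Integrable.congr hV ?_
    filter_upwards [hs] with x hx
    rw [hx]
  · refine Integrable.congr hw ?_
    filter_upwards [traction_work_mulVec hB ht hG] with x hx
    rw [hx]

lemma totalPotential_mulVec (hB : IsRegularBody B N)
    (hR : R ∈ Matrix.specialOrthogonalGroup (Fin 3) ℝ)
    (ht : ∀ᵐ x ∂((surf B).restrict (tractionBoundary B Sx)), Rᵀ *ᵥ t x = t x)
    (hχ : GeomAdmissible B Sx χ) :
    totalPotential B Sx t V (fun x => R *ᵥ χ x) = totalPotential B Sx t V χ := by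
  unfold totalPotential
  congr 1
  · refine integral_congr_ae ?_
    filter_upwards [strain_grad_mulVec hB hR hχ] with x hx
    rw [hx]
  · exact integral_congr_ae (traction_work_mulVec hB ht hχ)

lemma IsVariation.mulVec (hφ : IsVariation B Sx φ) (R : Mat) :
    IsVariation B Sx fun x => R *ᵥ φ x := by
  refine ⟨contDiff_pi.2 fun i => ?_, ?_⟩
  · simp only [Matrix.mulVec, dotProduct]
    exact ContDiff.sum fun k _ => contDiff_const.mul (contDiff_pi.1 hφ.1 k)
  filter_upwards [hφ.2] with x hx
  rw [hx, Matrix.mulVec_zero]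

/-- A variation `φ` of `Rχ` is the rotation of the variation `Rᵀφ` of `χ`. -/
lemma IsStationaryP.mulVec (hB : IsRegularBody B N)
    (hR : R ∈ Matrix.specialOrthogonalGroup (Fin 3) ℝ)
    (ht : ∀ᵐ x ∂((surf B).restrict (tractionBoundary B Sx)), Rᵀ *ᵥ t x = t x)
    (hχ : IsStationaryP B Sx t V p χ) : IsStationaryP B Sx t V p fun x => R *ᵥ χ x := by
  refine ⟨hχ.1.mulVec hB hR ht, fun φ hφ => ?_⟩
  obtain ⟨h1, h2⟩ := hχ.2 _ (hφ.mulVec Rᵀ)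
  have e (s : ℝ) : (fun x => R *ᵥ χ x) + s • φ =
      fun x => R *ᵥ (χ + s • fun y => Rᵀ *ᵥ φ y) x := by
    ext1 x
    simp only [Pi.add_apply, Pi.smul_apply]
    rw [Matrix.mulVec_add, Matrix.mulVec_smul, Matrix.mulVec_mulVec, self_mul_transpose_of_mem hR,
      Matrix.one_mulVec]
  simp_rw [e]
  refine ⟨h1.mono fun s hs => hs.mulVec hB hR ht, h2.congr_of_eventuallyEq ?_⟩
  filter_upwards [h1] with s hs
  exact totalPotential_mulVec hB hR ht hs.1

end Elastic

end Elasticity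

theorem theorem1 (B : Set Elasticity.Space) (N : Elasticity.Space → Elasticity.Vec)
    (hB : Elasticity.IsRegularBody B N)
    (Sx : Set Elasticity.Space) (hSx : Sx ⊆ frontier B) (hSxm : MeasurableSet Sx)
    (t : Elasticity.Space → Elasticity.Vec)
    (V : ℝ → ℝ) (hV : Elasticity.IsCanonical V) (p : ENNReal) (hp : 1 ≤ p)
    (T : Elasticity.Space → Elasticity.Mat) (hT : Elasticity.StatAdmissible B N Sx t T) :
    (∀ χ : Elasticity.Space → Elasticity.Vec,
      Elasticity.IsStationaryPT B Sx t V p T χ → Elasticity.IsStationaryP B Sx t V p χ) ∧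
    (∀ R : Elasticity.Space → Elasticity.Mat, Elasticity.IsRotationField B R →
      Elasticity.StatAdmissible B N Sx t (fun x => (R x).transpose * T x) →
      ∀ χ : Elasticity.Space → Elasticity.Vec, Elasticity.KinAdmissible B Sx t V p χ →
        Elasticity.FiniteStressWork B T (Elasticity.grad B χ) →
        Elasticity.canonicalPotential B V T (Elasticity.grad B χ) =
          Elasticity.canonicalPotential B V T (fun x => R x * Elasticity.grad B χ x)) ∧
    (∀ R ∈ Matrix.specialOrthogonalGroup (Fin 3) ℝ,
      Elasticity.StatAdmissible B N Sx t (fun x => R.transpose * T x) →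
      ∀ χ : Elasticity.Space → Elasticity.Vec, Elasticity.IsStationaryP B Sx t V p χ →
        Elasticity.IsStationaryP B Sx t V p (fun x => R.mulVec (χ x))) := by
  refine ⟨fun χ hχ => hχ.isStationaryP hB hSxm hT, fun R hR hRT χ hχ hF => ?_,
    fun R hR hRT χ hχ => ?_⟩
  · exact Elasticity.canonicalPotential_rotation hB hSxm hT hR hRT hχ hF
  · exact hχ.mulVec hB hR (hT.transpose_mulVec_traction hB hRT)
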